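/- Consider $N$ vehicles, the leaders $1,\dots,n+1$ ($n\in\{1,2,3\}$) and the followers $n+2,\dots,N$, together with $N_a$ auxiliary nodes, with reference positions $\mathbf r_{i,0}\in\mathbb R^n$ (the first $n$ position components; the remaining ones are zero). For points $\mathbf p_1,\dots,\mathbf p_{n+1}$ forming an $n$-dimensional simplex let $\mathbf\Theta_n(\mathbf p_1,\dots,\mathbf p_{n+1},\mathbf c)=\begin{bmatrix}\mathbf p_1&\cdots&\mathbf p_{n+1}\\1&\cdots&1\end{bmatrix}^{-1}\begin{bmatrix}\mathbf c\\1\end{bmatrix}$. The leaders form an $n$-dimensional simplex; each follower $i$ has $n+1$ in-neighbors $i_1,\dots,i_{n+1}$ among the nodes other than $i$, which form an $n$-dimensional simplex; the in-neighbors of every auxiliary node are the leaders; leaders have none. The weights of a non-leader node $i$ are $(w_{i,i_1},\dots,w_{i,i_{n+1}})^T=\mathbf\Theta_n(\mathbf r_{i_1,0},\dots,\mathbf r_{i_{n+1},0},\mathbf r_{i,0})$. Let $\mathbf W$ have diagonal entries $-1$, entries $w_{i,j}$ for $j$ an in-neighbor of $i$, and zeros elsewhere; let $\mathbf A,\mathbf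 W_{f,l},\mathbf W_{f,a},\mathbf W_{a,l}$ be its follower–follower, follower–leader, follower–auxiliary and auxiliary–leader blocks, and put $\mathbf B=\mathbf W_{f,l}+\mathbf W_{f,a}\mathbf W_{a,l}$ and $\mathbf L=\begin{bmatrix}-\mathbf I_{n+1}&\mathbf 0\\\mathbf B&\mathbf A\end{bmatrix}$. Let $\rho_x,\rho_y,\rho_z\ge 1$ be the relative degrees, $\Xi\ge0$ an integer with $\Xi<\rho_q$ for all $q$, and $\gamma_{j,i}$ real control gains, $\mathbf\Gamma_j=\mathrm{diag}(\gamma_{j,1},\dots,\gamma_{j,N})$. For $q\in\{x,y,z\}$ let $\mathbf H_{j,q}=-\mathbf I_N$ for $1\le j\le\rho_q-\Xi-1$ and $\mathbf H_{j,q}=\mathbf L$ for $\rho_q-\Xi\le j\le\rho_q$; let $\mathbf A_{\mathrm{SYS},q}$ be the block companion matrix with $N\times N$ blocks, identity blocks on the first block superdiagonal, last block row $[\mathbf\Gamma_{\rho_q}\mathbf H_{\rho_q,q}\ \ \mathbf\Gamma_{\rho_q-1}\mathbf H_{\rho_q-1,q}\ \cdots\ \mathbf\Gamma_1\mathbf H_{1,q}]$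 and zero blocks elsewhere; and let $\mathbf A_{\mathrm{SYS}}=\mathrm{diag}(\mathbf A_{\mathrm{SYS},x},\mathbf A_{\mathrm{SYS},y},\mathbf A_{\mathrm{SYS},z})$. The error dynamics of the collective system are $$\dot{\mathbf E}_{\mathrm{SYS}}=\mathbf A_{\mathrm{SYS}}\mathbf E_{\mathrm{SYS}}+\begin{bmatrix}\mathbf 0\\\mathbf I\end{bmatrix}\mathbf V_{\mathrm{SYS}},$$ where $\mathbf V_{\mathrm{SYS}}\in\mathbb R^{3N}$ enters the equations of the highest derivative of each component. The internal dynamics are $\dot\omega=\mathbf F_{\mathrm{INT}}(\omega,\mathbf X_{\mathrm{SYS}})$, where $\omega=(\omega_1,\dots,\omega_N)$ and $\mathbf F_{\mathrm{INT}}=(\mathbf f_{\mathrm{int},1},\dots,\mathbf f_{\mathrm{int},N})$, and $\mathbf f_{\mathrm{int},i}$ is a function, $C^1$ near the origin, of $\omega_i$ and of the derivatives of order $0,\dots,\rho_q-1$ of the position components $q\in\{x,y,z\}$ of vehicle $i$. **Theorem 2.** Assume that the gains are such that for each $q\in\{x,y,z\}$ all roots of $|s\mathbf I-\mathbf A_{\mathrm{SYS},q}|=0$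 lie in the open left half-plane, that the zero dynamics $\dot\omega=\mathbf F_{\mathrm{INT}}(\omega,\mathbf 0)$ is locally asymptotically stable at the origin, and that the Jacobian matrix $\partial\mathbf F_{\mathrm{INT}}/\partial\omega$ at the origin is Hurwitz. Then the error zero dynamics (put $\mathbf V_{\mathrm{SYS}}=\mathbf 0$) is locally asymptotically stable at the origin: this holds for the error system $\dot{\mathbf E}_{\mathrm{SYS}}=\mathbf A_{\mathrm{SYS}}\mathbf E_{\mathrm{SYS}}$ alone, and also for the collective zero dynamics $$\dot{\mathbf E}_{\mathrm{SYS}}=\mathbf A_{\mathrm{SYS}}\mathbf E_{\mathrm{SYS}},\qquad\dot\omega=\mathbf F_{\mathrm{INT}}(\omega,\mathbf E_{\mathrm{SYS}})$$ at $(\mathbf E_{\mathrm{SYS}},\omega)=(\mathbf 0,\mathbf 0)$. -/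

import Mathlib

open Filter Topology
open scoped Matrix

noncomputable section

/-! ### Stability notions -/

/-- `x` solves `x' = f x` on the time interval `[0, ∞)`. -/
def IsForwardSolution {E : Type*} [NormedAddCommGroup E] [NormedSpace ℝ E]
    (f : E → E) (x : ℝ → E) : Prop :=
  ∀ t : ℝ, 0 ≤ t → HasDerivWithinAt x (f (x t)) (Set.Ici 0) t

/-- The origin is a locally asymptotically stable equilibrium of `x' = f x`: it is an equilibrium,
solutions starting near it exist for all forward time, it is Lyapunov stable, and it is locally
attractive. -/
structure IsLocallyAsymptoticallyStable {E : Type*} [NormedAddCommGroup E] [NormedSpace ℝ E]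
    (f : E → E) : Prop where
  equilibrium : f 0 = 0
  exists_solution : ∃ δ > 0, ∀ x₀ : E, ‖x₀‖ < δ → ∃ x : ℝ → E, x 0 = x₀ ∧ IsForwardSolution f x
  stable : ∀ ε > 0, ∃ δ > 0, ∀ x : ℝ → E, IsForwardSolution f x → ‖x 0‖ < δ →
    ∀ t : ℝ, 0 ≤ t → ‖x t‖ < ε
  attractive : ∃ δ > 0, ∀ x : ℝ → E, IsForwardSolution f x → ‖x 0‖ < δ →
    Tendsto x atTop (𝓝 0)

/-- All roots `s` of the characteristic equation `|s I - M| = 0` lie in the open left half-plane. -/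
def IsHurwitz {ι : Type*} [Fintype ι] [DecidableEq ι] (M : Matrix ι ι ℝ) : Prop :=
  ∀ s : ℂ, (s • (1 : Matrix ι ι ℂ) - M.map (fun a : ℝ => (a : ℂ))).det = 0 → s.re < 0

/-! ### Reference configuration and communication weights -/

/-- `Ψ_n(p₁, …, p_{n+1})`, the rank of `[p₂ - p₁ ⋯ p_{n+1} - p₁]`. -/
def simplexRank {n : ℕ} (p : Fin (n + 1) → Fin n → ℝ) : ℕ :=
  (Matrix.of fun (r : Fin n) (k : Fin n) => p k.succ r - p 0 r).rank

/-- The square matrix with columns `(p_k, 1)`. -/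
def simplexMatrix {n : ℕ} (p : Fin (n + 1) → Fin n → ℝ) : Matrix (Fin (n + 1)) (Fin (n + 1)) ℝ :=
  Matrix.of fun r k => Fin.snoc (α := fun _ => ℝ) (p k) 1 r

/-- `Θ_n(p₁, …, p_{n+1}, c)`, the barycentric coordinates of `c` in the simplex `p`. -/
def barycentric {n : ℕ} (p : Fin (n + 1) → Fin n → ℝ) (c : Fin n → ℝ) : Fin (n + 1) → ℝ :=
  (simplexMatrix p)⁻¹ *ᵥ Fin.snoc (α := fun _ => ℝ) c 1

/-- The vehicles: `n + 1` leaders followed by `F = N - n - 1` followers. -/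
abbrev Vehicle (n F : ℕ) : Type := Fin (n + 1) ⊕ Fin F

/-- The nodes: all vehicles together with `Na` auxiliary nodes. -/
abbrev Node (n F Na : ℕ) : Type := Vehicle n F ⊕ Fin Na

/-- The reference configuration of the multi-vehicle system. Leaders have no in-neighbors, the
in-neighbors of an auxiliary node are the `n + 1` leaders, and each follower has `n + 1`
in-neighbors. Reference positions are listed by their first `n` components (the others vanish). -/
structure ReferenceNetwork (n F Na : ℕ) where
  /-- reference positions -/
  pos : Node n F Na → Fin n → ℝ
  /-- the in-neighbors of each follower -/
  nbr : Fin F → Fin (n + 1) → Node n F Na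
  /-- the leaders form an `n`-dimensional simplex -/
  leader_simplex : simplexRank (fun k => pos (.inl (.inl k))) = n
  /-- the in-neighbors of a follower form an `n`-dimensional simplex -/
  nbr_simplex : ∀ i, simplexRank (fun k => pos (nbr i k)) = n
  /-- no follower is its own in-neighbor -/
  nbr_ne : ∀ i k, nbr i k ≠ .inl (.inr i)

namespace ReferenceNetwork

variable {n F Na : ℕ} (R : ReferenceNetwork n F Na)

/-- The weight matrix `W`. -/
def W : Matrix (Node n F Na) (Node n F Na) ℝ :=
  Matrix.of fun i j =>
    if i = j then -1 else
      match i with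
      | .inl (.inl _) => 0
      | .inl (.inr a) => ∑ k, if R.nbr a k = j then
          barycentric (fun k' => R.pos (R.nbr a k')) (R.pos (.inl (.inr a))) k else 0
      | .inr h => ∑ k, if (.inl (.inl k) : Node n F Na) = j then
          barycentric (fun k' => R.pos (.inl (.inl k'))) (R.pos (.inr h)) k else 0

/-- The follower-follower block `A` of `W`. -/
def A : Matrix (Fin F) (Fin F) ℝ := R.W.submatrix (fun i => .inl (.inr i)) (fun j => .inl (.inr j))

/-- The follower-leader block of `W`. -/
def Wfl : Matrix (Fin F) (Fin (n + 1)) ℝ :=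
  R.W.submatrix (fun i => .inl (.inr i)) (fun j => .inl (.inl j))

/-- The follower-auxiliary block of `W`. -/
def Wfa : Matrix (Fin F) (Fin Na) ℝ := R.W.submatrix (fun i => .inl (.inr i)) (fun j => .inr j)

/-- The auxiliary-leader block of `W`. -/
def Wal : Matrix (Fin Na) (Fin (n + 1)) ℝ := R.W.submatrix (fun i => .inr i) (fun j => .inl (.inl j))

/-- `B = W_{f,l} + W_{f,a} W_{a,l}`. -/
def B : Matrix (Fin F) (Fin (n + 1)) ℝ := R.Wfl + R.Wfa * R.Wal

/-- `L = [-I, 0; B, A]`. -/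
def L : Matrix (Vehicle n F) (Vehicle n F) ℝ := Matrix.fromBlocks (-1) 0 R.B R.A

/-! ### Collective dynamics -/

/-- `H_{j,q}` for `1 ≤ j ≤ ρ_q` (here `r = ρ_q`): `-I` for `j ≤ r - Ξ - 1` and `L` for
`r - Ξ ≤ j`. -/
def H (Ξ r j : ℕ) : Matrix (Vehicle n F) (Vehicle n F) ℝ := if j + Ξ + 1 ≤ r then -1 else R.L

/-- `A_{SYS,q}` (here `r = ρ_q`), in block companion form. Block index `k` stands for the `k`-th
time derivative; `γ j i` is the gain `γ_{j,i}`, used for `1 ≤ j ≤ r`. The last block row is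
`[Γ_r H_r, Γ_{r-1} H_{r-1}, …, Γ_1 H_1]` with `Γ_j = diag (γ_{j,i})_i`. -/
def ASysq (γ : ℕ → Vehicle n F → ℝ) (Ξ r : ℕ) :
    Matrix (Fin r × Vehicle n F) (Fin r × Vehicle n F) ℝ :=
  Matrix.of fun a b =>
    if (a.1 : ℕ) + 1 = r then
      (Matrix.diagonal (γ (r - b.1)) * R.H Ξ r (r - b.1)) a.2 b.2
    else if (b.1 : ℕ) = a.1 + 1 then (1 : Matrix (Vehicle n F) (Vehicle n F) ℝ) a.2 b.2
    else 0

end ReferenceNetwork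

/-- Index set of `X_SYS` and `E_SYS`: a component `q ∈ {x, y, z}`, a derivative order `k < ρ_q`, and
a vehicle. -/
abbrev ExtIndex (n F : ℕ) (ρ : Fin 3 → ℕ) : Type := (q : Fin 3) × (Fin (ρ q) × Vehicle n F)

/-- `A_SYS = diag (A_{SYS,x}, A_{SYS,y}, A_{SYS,z})`. -/
def ReferenceNetwork.ASys {n F Na : ℕ} (R : ReferenceNetwork n F Na)
    (γ : ℕ → Vehicle n F → ℝ) (Ξ : ℕ) (ρ : Fin 3 → ℕ) :
    Matrix (ExtIndex n F ρ) (ExtIndex n F ρ) ℝ :=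
  Matrix.blockDiagonal' fun q => R.ASysq γ Ξ (ρ q)

/-- The matrix `[0; I]` through which `V_SYS = (V_x, V_y, V_z)` enters the error dynamics: `V_q`
acts on the highest derivatives of component `q`. -/
def errorInput (n F : ℕ) (ρ : Fin 3 → ℕ) : Matrix (ExtIndex n F ρ) (Fin 3 × Vehicle n F) ℝ :=
  Matrix.of fun a v => if (a.2.1 : ℕ) + 1 = ρ a.1 ∧ a.1 = v.1 ∧ a.2.2 = v.2 then 1 else 0

/-- Right-hand side of the error dynamics `E' = A_SYS E + [0; I] V`. -/
def ReferenceNetwork.errorField {n F Na : ℕ} (R : ReferenceNetwork n F Na)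
    (γ : ℕ → Vehicle n F → ℝ) (Ξ : ℕ) (ρ : Fin 3 → ℕ)
    (V : Fin 3 × Vehicle n F → ℝ) (E : ExtIndex n F ρ → ℝ) : ExtIndex n F ρ → ℝ :=
  R.ASys γ Ξ ρ *ᵥ E + errorInput n F ρ *ᵥ V

/-- `F_INT(ω, X)`, the stack of the internal dynamics `f_{int,i}` of the vehicles. The function
`f_{int,i}` depends on the internal state of vehicle `i` and on the derivatives of order `k < ρ_q`
of its position components `q`. -/
def FInt {n F m : ℕ} {ρ : Fin 3 → ℕ}
    (fint : Vehicle n F → (Fin m → ℝ) → (((q : Fin 3) × Fin (ρ q)) → ℝ) → (Fin m → ℝ))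
    (ω : Vehicle n F × Fin m → ℝ) (X : ExtIndex n F ρ → ℝ) : Vehicle n F × Fin m → ℝ :=
  fun a => fint a.1 (fun b => ω (a.1, b)) (fun c => X ⟨c.1, (c.2, a.1)⟩) a.2

/-- The Jacobian matrix `∂F_INT/∂ω` at the origin `(ω, X) = (0, 0)`. -/
def FIntJacobian {n F m : ℕ} {ρ : Fin 3 → ℕ}
    (fint : Vehicle n F → (Fin m → ℝ) → (((q : Fin 3) × Fin (ρ q)) → ℝ) → (Fin m → ℝ)) :
    Matrix (Vehicle n F × Fin m) (Vehicle n F × Fin m) ℝ :=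
  LinearMap.toMatrix' (fderiv ℝ (fun ω => FInt fint ω 0) 0).toLinearMap

end

/-! ### Global existence for bounded Lipschitz vector fields -/

/-! The error drives the internal state but not conversely, so the linearization of the collective
system at the origin is block triangular, with diagonal blocks `A_SYS` and `∂F_INT/∂ω`. Both are
Hurwitz: the first because it is block diagonal with Hurwitz blocks, the second by hypothesis.
Stability then follows by linearization.

The notion that carries this is `HasContractingEulerSteps`: in some equivalent norm, the Euler steps
`1 + s A` contract at rate `1 - c s`. If `M` is Hurwitz, a small `h` puts the eigenvalues of `1 + h
M` inside the unit disc, so its powers tend to zero and an adapted norm exists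
(`IsHurwitz.hasContractingEulerSteps`). A weighted sum of two adapted norms handles triangular
systems (`HasContractingEulerSteps.prod`). For a `C¹` field, the nonlinear remainder costs only part
of the rate near the origin, and a comparison argument gives exponential decay
(`IsForwardSolution.seminorm_le_exp`). Existence of solutions comes from truncating the field. -/

theorem exists_hasDerivAt_of_lipschitzWith_of_bounded {E : Type*} [NormedAddCommGroup E]
    [NormedSpace ℝ E] [CompleteSpace E] {g : E → E} {K : NNReal} (hg : LipschitzWith K g)
    {C : ℝ} (hC : ∀ x, ‖g x‖ ≤ C) (x₀ : E) :
    ∃ x : ℝ → E, x 0 = x₀ ∧ ∀ t, HasDerivAt x (g (x t)) t := by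
  have hC0 : 0 ≤ C := (norm_nonneg _).trans (hC x₀)
  have local_sol : ∀ T : ℝ, 0 < T → ∃ x : ℝ → E, x 0 = x₀ ∧
      ∀ t ∈ Set.Ioo (-T) T, HasDerivAt x (g (x t)) t := by
    intro T hT
    -- As `‖g‖ ≤ C` everywhere, the ball of radius `C * T` cannot be left before time `T`, so any
    -- `T` is admissible.
    have hpl : IsPicardLindelof (fun _ => g) (tmin := -T) (tmax := T)
        ⟨0, by constructor <;> linarith⟩ x₀ (C.toNNReal * T.toNNReal) 0 C.toNNReal K :=
      { lipschitzOnWith := fun _ _ => hg.lipschitzOnWith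
        continuousOn := fun _ _ => continuousOn_const
        norm_le := fun _ _ x _ => by rw [Real.coe_toNNReal _ hC0]; exact hC x
        mul_max_le := by simp [hC0, hT.le] }
    obtain ⟨x, hx0, hx⟩ := hpl.exists_eq_forall_mem_Icc_hasDerivWithinAt₀
    exact ⟨x, hx0, fun t ht => (hx t (Set.Ioo_subset_Icc_self ht)).hasDerivAt
      (Icc_mem_nhds ht.1 ht.2)⟩
  choose! x hx0 hx using local_sol
  have agree : ∀ S T t : ℝ, |t| < S → S ≤ T → x S t = x T t := by
    intro S T t hS hST
    have hS0 : 0 < S := (abs_nonneg t).trans_lt hS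
    refine ODE_solution_unique_of_mem_Ioo (v := fun _ => g) (s := fun _ => Set.univ)
      (a := -S) (b := S) (t₀ := 0) (fun _ _ => hg.lipschitzOnWith) ⟨by linarith, hS0⟩
      (fun t ht => ⟨hx S hS0 t ht, trivial⟩)
      (fun t ht => ⟨hx T (hS0.trans_le hST) t ⟨by linarith [ht.1], by linarith [ht.2]⟩, trivial⟩)
      (by rw [hx0 S hS0, hx0 T (hS0.trans_le hST)]) (abs_lt.1 hS)
  -- Gluing: the value at `t` comes from a solution whose interval contains `t`. Near `t` all of
  -- these agree with the single solution `x (|t| + 2)`.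
  refine ⟨fun t => x (|t| + 1) t, hx0 _ (by positivity), fun t => ?_⟩
  have hpos : 0 < |t| + 2 := by positivity
  have key : HasDerivAt (x (|t| + 2)) (g (x (|t| + 2) t)) t :=
    hx _ hpos t (abs_lt.1 (by linarith))
  have ev : (fun s => x (|s| + 1) s) =ᶠ[𝓝 t] x (|t| + 2) := by
    have : ∀ᶠ s in 𝓝 t, |s| < |t| + 1 :=
      continuous_abs.continuousAt.eventually (gt_mem_nhds (by linarith))
    filter_upwards [this] with s hs
    exact agree _ _ s (by linarith) (by linarith)
  simpa only [ev.eq_of_nhds] using key.congr_of_eventuallyEq ev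

/-! ### Decay along trajectories in an adapted norm -/

section Decay

variable {E : Type*} [NormedAddCommGroup E] [NormedSpace ℝ E]

/-- `N ∘ x` need not be differentiable, but its right slopes are controlled by one Euler step, since
`x z` differs from that step by `o(z - t)` and `N` is dominated by the norm. -/
theorem Seminorm.frequently_slope_comp_lt {N : Seminorm ℝ E} {M : ℝ} (hM : ∀ x, N x ≤ M * ‖x‖)
    {x : ℝ → E} {w : E} {t : ℝ} (hx : HasDerivWithinAt x w (Set.Ioi t) t) {a r : ℝ}
    (ha : ∀ᶠ s in 𝓝[>] (0 : ℝ), N (x t + s • w) ≤ N (x t) + s * a) (har : a < r) :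
    ∃ᶠ z in 𝓝[>] t, slope (fun τ => N (x τ)) t z < r := by
  apply Eventually.frequently
  obtain ⟨ε, hε, hεr⟩ : ∃ ε > 0, |M| * ε < r - a :=
    ⟨(r - a) / (|M| + 1), by have := sub_pos.2 har; positivity, by
      have h1 := sub_pos.2 har
      rw [mul_div_assoc', div_lt_iff₀ (by positivity)]; nlinarith [abs_nonneg M]⟩
  have h1 := (hasDerivWithinAt_iff_isLittleO.1 hx).def hε
  have h2 : Tendsto (fun z => z - t) (𝓝[>] t) (𝓝[>] 0) := by
    refine tendsto_nhdsWithin_iff.2 ⟨?_, ?_⟩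
    · have : Tendsto (fun z => z - t) (𝓝 t) (𝓝 (t - t)) := (continuous_sub_right t).tendsto t
      rw [sub_self] at this
      exact this.mono_left nhdsWithin_le_nhds
    · filter_upwards [self_mem_nhdsWithin] with z hz using sub_pos.2 (Set.mem_Ioi.1 hz)
  filter_upwards [h1, h2.eventually ha, self_mem_nhdsWithin] with z hz1 hz2 hz
  have hz : 0 < z - t := sub_pos.2 (Set.mem_Ioi.1 hz)
  rw [slope_def_field, div_lt_iff₀ hz]
  rw [Real.norm_of_nonneg hz.le] at hz1
  have h3 : N (x z) ≤ N (x t + (z - t) • w) + N (x z - x t - (z - t) • w) := by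
    have := map_add_le_add N (x t + (z - t) • w) (x z - x t - (z - t) • w)
    rwa [show x t + (z - t) • w + (x z - x t - (z - t) • w) = x z by abel] at this
  have h4 : N (x z - x t - (z - t) • w) ≤ |M| * (ε * (z - t)) :=
    (hM _).trans ((mul_le_mul_of_nonneg_right (le_abs_self M) (norm_nonneg _)).trans
      (mul_le_mul_of_nonneg_left hz1 (abs_nonneg M)))
  nlinarith [mul_lt_mul_of_pos_right hεr hz]

/-- The barrier `η exp(-(c/2) t)` stays below `δ`, so at a contact point the decay rate `c` applies.
It strictly beats the barrier's rate `c/2`, which rules out a crossing. -/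
theorem IsForwardSolution.seminorm_le_exp {N : Seminorm ℝ E} {M : ℝ} (hM : ∀ x, N x ≤ M * ‖x‖)
    {f : E → E} {c δ : ℝ} (hc : 0 < c)
    (hf : ∀ v, N v < δ → ∀ᶠ s in 𝓝[>] (0 : ℝ), N (v + s • f v) ≤ N v + s * (-c * N v))
    {x : ℝ → E} (hx : IsForwardSolution f x) {η : ℝ} (hη : 0 < η) (hηδ : η < δ)
    (hx0 : N (x 0) ≤ η) {t : ℝ} (ht : 0 ≤ t) : N (x t) ≤ η * Real.exp (-(c / 2) * t) := by
  have hNc : Continuous N := by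
    have : LipschitzWith (|M|).toNNReal N := by
      refine LipschitzWith.of_dist_le_mul fun u v => ?_
      rw [Real.coe_toNNReal _ (abs_nonneg M), dist_eq_norm, dist_eq_norm, Real.norm_eq_abs]
      exact (abs_sub_map_le_sub N u v).trans ((hM _).trans
        (mul_le_mul_of_nonneg_right (le_abs_self M) (norm_nonneg _)))
    exact this.continuous
  have hcont : ContinuousOn (fun τ => N (x τ)) (Set.Icc 0 t) :=
    hNc.comp_continuousOn fun τ hτ => (hx τ hτ.1).continuousWithinAt.mono fun s hs => hs.1
  refine image_le_of_liminf_slope_right_lt_deriv_boundary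
    (B := fun τ => η * Real.exp (-(c / 2) * τ))
    -- A slope bound is needed at every time. Outside the region `N < δ` the triangle inequality
    -- gives a crude one, which no contact point ever sees.
    (f' := fun τ => if N (x τ) < δ then -c * N (x τ) else N (f (x τ)))
    (B' := fun τ => η * (Real.exp (-(c / 2) * τ) * (-(c / 2)))) hcont
    (fun τ hτ r hr => ?_) (by simpa using hx0) (fun τ => ?_) (fun τ hτ hτB => ?_) ⟨ht, le_rfl⟩
  · have hd : HasDerivWithinAt x (f (x τ)) (Set.Ioi τ) τ :=
      (hx τ hτ.1).mono fun s hs => hτ.1.trans (le_of_lt hs)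
    refine Seminorm.frequently_slope_comp_lt hM hd ?_ hr
    split_ifs with h
    · exact hf _ h
    · filter_upwards [self_mem_nhdsWithin] with s hs
      refine (map_add_le_add N _ _).trans ?_
      rw [map_smul_eq_mul, Real.norm_of_nonneg (le_of_lt hs)]
  · have h1 : HasDerivAt (fun τ : ℝ => -(c / 2) * τ) (-(c / 2)) τ := by
      simpa using (hasDerivAt_id τ).const_mul (-(c / 2))
    exact h1.exp.const_mul η
  · have hexp : Real.exp (-(c / 2) * τ) ≤ 1 :=
      Real.exp_le_one_iff.2 (by nlinarith [hτ.1])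
    have hpos : 0 < η * Real.exp (-(c / 2) * τ) := by positivity
    have hlt : N (x τ) < δ := by rw [hτB]; nlinarith
    simp only [if_pos hlt]
    rw [hτB]
    nlinarith

/-- `A` is uniformly contracting in a suitable norm: the explicit Euler steps of `x' = A x`
with small step size are contractions with a rate proportional to the step. -/
def HasContractingEulerSteps (A : E →L[ℝ] E) : Prop :=
  ∃ N : Seminorm ℝ E, (∀ x, ‖x‖ ≤ N x) ∧ (∃ M > 0, ∀ x, N x ≤ M * ‖x‖) ∧
    ∃ c > 0, ∃ h > 0, ∀ s, 0 ≤ s → s ≤ h → ∀ x, N (x + s • A x) ≤ (1 - c * s) * N x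

/-- A bump function makes the field globally Lipschitz and bounded without changing it near the
origin, so that global solutions exist. -/
theorem exists_contDiff_hasCompactSupport_eq_near_zero [FiniteDimensional ℝ E] {f : E → E}
    (hf : ContDiffAt ℝ 1 f 0) :
    ∃ g : E → E, ContDiff ℝ 1 g ∧ HasCompactSupport g ∧ ∃ δ > 0, ∀ x, ‖x‖ < δ → g x = f x := by
  obtain ⟨ε, hε, hball⟩ := Metric.eventually_nhds_iff.1 (hf.eventually (by simp))
  let φ : ContDiffBump (0 : E) := ⟨ε / 4, ε / 2, by positivity, by linarith⟩
  refine ⟨fun x => φ x • f x, ?_, φ.hasCompactSupport.smul_right, ε / 4, by positivity,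
    fun x hx => ?_⟩
  · refine contDiff_iff_contDiffAt.2 fun x => ?_
    by_cases hx : dist x 0 < ε
    · exact φ.contDiffAt.smul (hball hx)
    · have hxt : x ∉ tsupport (φ : E → ℝ) := by
        rw [φ.tsupport_eq, Metric.mem_closedBall]
        change ¬ dist x 0 ≤ ε / 2
        linarith
      have hz : (fun x => φ x • f x) =ᶠ[𝓝 x] fun _ => 0 := by
        filter_upwards [notMem_tsupport_iff_eventuallyEq.1 hxt] with y hy
        simp [hy]
      exact contDiffAt_const.congr_of_eventuallyEq hz
  · have : φ x = 1 := φ.one_of_mem_closedBall (by simpa [φ] using hx.le)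
    simp [this]

/-- Stability by linearization. -/
theorem HasContractingEulerSteps.isLocallyAsymptoticallyStable [FiniteDimensional ℝ E]
    {f : E → E} (hf : ContDiffAt ℝ 1 f 0) (h0 : f 0 = 0)
    (hA : HasContractingEulerSteps (fderiv ℝ f 0)) : IsLocallyAsymptoticallyStable f := by
  obtain ⟨N, hN, ⟨M, hM0, hM⟩, c, hc, h, hh, hstep⟩ := hA
  set A := fderiv ℝ f 0 with hAdef
  -- The little-o constant `c / 2 / M` is chosen so that, measured in `N`, the remainder consumes
  -- half of the contraction rate.
  obtain ⟨δ, hδ, hlin⟩ : ∃ δ > 0, ∀ v, N v < δ → N (f v - A v) ≤ c / 2 * N v := by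
    have hd : HasFDerivAt f A 0 := (hf.differentiableAt (by simp)).hasFDerivAt
    have hlo := (hasFDerivAt_iff_isLittleO_nhds_zero.1 hd).def (c := c / 2 / M) (by positivity)
    obtain ⟨δ, hδ, hball⟩ := Metric.eventually_nhds_iff.1 hlo
    refine ⟨δ, hδ, fun v hv => ?_⟩
    have h1 := hball (y := v) (by rw [dist_zero_right]; exact (hN v).trans_lt hv)
    rw [zero_add, h0, sub_zero] at h1
    calc N (f v - A v) ≤ M * ‖f v - A v‖ := hM _
      _ ≤ M * (c / 2 / M * ‖v‖) := by gcongr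
      _ = c / 2 * ‖v‖ := by field_simp
      _ ≤ c / 2 * N v := by gcongr; exact hN v
  have euler : ∀ v, N v < δ →
      ∀ᶠ s in 𝓝[>] (0 : ℝ), N (v + s • f v) ≤ N v + s * (-(c / 2) * N v) := by
    intro v hv
    filter_upwards [Ioc_mem_nhdsGT hh] with s hs
    have h1 : N (v + s • f v) ≤ N (v + s • A v) + s * N (f v - A v) := by
      have := map_add_le_add N (v + s • A v) (s • (f v - A v))
      rw [map_smul_eq_mul, Real.norm_of_nonneg hs.1.le] at this
      rwa [show v + s • A v + s • (f v - A v) = v + s • f v by rw [smul_sub]; abel] at this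
    nlinarith [hstep s hs.1.le hs.2 v, mul_le_mul_of_nonneg_left (hlin v hv) hs.1.le]
  have small : ∀ η : ℝ, ∀ v : E, ‖v‖ < η / M → N v ≤ η := by
    intro η v hv
    rw [lt_div_iff₀ hM0] at hv
    linarith [hM v]
  refine ⟨h0, ?_, fun ε hε => ?_, ?_⟩
  -- The truncated field has a global solution. Decay keeps it where `g = f`, so it also solves the
  -- original equation.
  · obtain ⟨g, hg, hgc, ρ, hρ, hgf⟩ := exists_contDiff_hasCompactSupport_eq_near_zero hf
    obtain ⟨K, hK⟩ := hg.lipschitzWith_of_hasCompactSupport hgc one_ne_zero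
    obtain ⟨C, hC⟩ := hgc.exists_bound_of_continuous hg.continuous
    set δ' := min δ ρ with hδ'
    have hδ'0 : 0 < δ' := lt_min hδ hρ
    refine ⟨δ' / 2 / M, by positivity, fun x₀ hx₀ => ?_⟩
    obtain ⟨x, hx0, hx⟩ := exists_hasDerivAt_of_lipschitzWith_of_bounded hK hC x₀
    have hxg : IsForwardSolution g x := fun t _ => (hx t).hasDerivWithinAt
    refine ⟨x, hx0, fun t ht => ?_⟩
    have hdecay := hxg.seminorm_le_exp hM (half_pos hc) (δ := δ') (fun v hv => by
      rw [hgf v ((hN v).trans_lt (hv.trans_le (min_le_right _ _)))]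
      exact euler v (hv.trans_le (min_le_left _ _))) (half_pos hδ'0) (half_lt_self hδ'0)
      (by rw [hx0]; exact small _ _ hx₀) ht
    have hexp : Real.exp (-(c / 2 / 2) * t) ≤ 1 := Real.exp_le_one_iff.2 (by nlinarith)
    have hxt : ‖x t‖ < ρ := by
      have := min_le_right δ ρ
      nlinarith [hN (x t)]
    rw [← hgf _ hxt]
    exact hxg t ht
  · set η := min (δ / 2) (ε / 2)
    have hη : 0 < η := lt_min (by positivity) (by positivity)
    have hηδ : η < δ := (min_le_left _ _).trans_lt (half_lt_self hδ)
    have hηε : η < ε := (min_le_right _ _).trans_lt (half_lt_self hε)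
    refine ⟨η / M, by positivity, fun x hx hx0 t ht => ?_⟩
    have hdecay := hx.seminorm_le_exp hM (half_pos hc) euler hη hηδ (small _ _ hx0) ht
    have hexp : Real.exp (-(c / 2 / 2) * t) ≤ 1 := Real.exp_le_one_iff.2 (by nlinarith)
    nlinarith [hN (x t)]
  · refine ⟨δ / 2 / M, by positivity, fun x hx hx0 => ?_⟩
    have hlim : Tendsto (fun t : ℝ => δ / 2 * Real.exp (-(c / 2 / 2) * t)) atTop (𝓝 0) := by
      have h1 : Tendsto (fun t : ℝ => -(c / 2 / 2) * t) atTop atBot :=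
        tendsto_id.const_mul_atTop_of_neg (by linarith)
      simpa using (Real.tendsto_exp_atBot.comp h1).const_mul (δ / 2)
    refine squeeze_zero_norm' ?_ hlim
    filter_upwards [eventually_ge_atTop 0] with t ht
    exact (hN _).trans (hx.seminorm_le_exp hM (half_pos hc) euler (half_pos hδ)
      (half_lt_self hδ) (small _ _ hx0) ht)

end Decay

/-! ### Adapted norms and block triangular operators -/

section Decay

variable {E : Type*} [NormedAddCommGroup E] [NormedSpace ℝ E]

/-- With `‖B ^ m‖ ≤ 1/2 = r ^ m`, take `N x = ∑_{k<m} r⁻ᵏ ‖Bᵏ x‖`. Applying `B` shifts the sum, and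
the new last term is at most the dropped `‖x‖`, so `N (B x) ≤ r * N x`. For `s ≤ h`, the step `1 + s
A` is a convex combination of `1` and `B`. -/
theorem hasContractingEulerSteps_of_tendsto_pow {A : E →L[ℝ] E} {h : ℝ} (hh : 0 < h)
    (hA : Tendsto (fun k : ℕ => (1 + h • A) ^ k) atTop (𝓝 0)) : HasContractingEulerSteps A := by
  set B : E →L[ℝ] E := 1 + h • A with hB
  obtain ⟨m, hm, hBm⟩ : ∃ m : ℕ, 0 < m ∧ ‖B ^ m‖ ≤ 1 / 2 := by
    have h1 := (tendsto_zero_iff_norm_tendsto_zero.1 hA).eventually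
      (ge_mem_nhds (show (0 : ℝ) < 1 / 2 by norm_num))
    obtain ⟨m, h2, h3⟩ := (h1.and (eventually_gt_atTop 0)).exists
    exact ⟨m, h3, h2⟩
  obtain ⟨r, hr0, hr1, hrm⟩ : ∃ r : ℝ, 0 < r ∧ r < 1 ∧ r ^ m = 1 / 2 :=
    ⟨(1 / 2 : ℝ) ^ (m : ℝ)⁻¹, by positivity,
      Real.rpow_lt_one (by norm_num) (by norm_num) (by positivity),
      Real.rpow_inv_natCast_pow (by norm_num) hm.ne'⟩
  let N : Seminorm ℝ E := ∑ k ∈ Finset.range m,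
    NNReal.mk (r ^ k)⁻¹ (by positivity) • (normSeminorm ℝ E).comp (B ^ k).toLinearMap
  have hN : ∀ x, N x = ∑ k ∈ Finset.range m, (r ^ k)⁻¹ * ‖(B ^ k) x‖ := by
    intro x
    rw [sum_apply]
    rfl
  have hcontr : ∀ x, N (B x) ≤ r * N x := by
    intro x
    have e1 : N (B x) = r * ∑ k ∈ Finset.range m, (r ^ (k + 1))⁻¹ * ‖(B ^ (k + 1)) x‖ := by
      rw [hN, Finset.mul_sum]
      refine Finset.sum_congr rfl fun k _ => ?_
      rw [pow_succ B, mul_apply_eq_comp, pow_succ r]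
      field_simp
    have e2 : ∑ k ∈ Finset.range m, (r ^ (k + 1))⁻¹ * ‖(B ^ (k + 1)) x‖ + ‖x‖ =
        N x + (r ^ m)⁻¹ * ‖(B ^ m) x‖ := by
      rw [hN, ← Finset.sum_range_succ (fun k => (r ^ k)⁻¹ * ‖(B ^ k) x‖), Finset.sum_range_succ']
      simp
    have e3 : (r ^ m)⁻¹ * ‖(B ^ m) x‖ ≤ ‖x‖ := by
      rw [hrm]
      have := (B ^ m).le_of_opNorm_le hBm x
      linarith
    rw [e1]
    exact mul_le_mul_of_nonneg_left (by linarith) hr0.le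
  refine ⟨N, fun x => ?_, ⟨∑ k ∈ Finset.range m, (r ^ k)⁻¹ * ‖B ^ k‖ + 1, ?_, fun x => ?_⟩,
    (1 - r) / h, div_pos (by linarith) hh, h, hh, fun s hs0 hsh x => ?_⟩
  · rw [hN]
    have := Finset.single_le_sum (f := fun k => (r ^ k)⁻¹ * ‖(B ^ k) x‖)
      (fun k _ => by positivity) (Finset.mem_range.2 hm)
    simpa using this
  · have : 0 ≤ ∑ k ∈ Finset.range m, (r ^ k)⁻¹ * ‖B ^ k‖ :=
      Finset.sum_nonneg fun k _ => by positivity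
    linarith
  · rw [hN, add_mul, Finset.sum_mul, one_mul]
    refine le_add_of_le_of_nonneg (Finset.sum_le_sum fun k _ => ?_) (norm_nonneg x)
    rw [mul_assoc]
    exact mul_le_mul_of_nonneg_left ((B ^ k).le_opNorm x) (by positivity)
  · have hs1 : s / h ≤ 1 := (div_le_one hh).2 hsh
    have hdecomp : x + s • A x = (1 - s / h) • x + (s / h) • B x := by
      have : (s / h) • (h • A x) = s • A x := by rw [smul_smul, div_mul_cancel₀ _ hh.ne']
      simp only [hB, add_apply, one_apply_eq_self,
        smul_apply, smul_add, this, sub_smul, one_smul]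
      abel
    calc N (x + s • A x) ≤ (1 - s / h) * N x + (s / h) * N (B x) := by
          rw [hdecomp]
          refine (map_add_le_add N _ _).trans ?_
          rw [map_smul_eq_mul, map_smul_eq_mul, Real.norm_of_nonneg (by linarith),
            Real.norm_of_nonneg (by positivity)]
      _ ≤ (1 - s / h) * N x + (s / h) * (r * N x) := by
          have := hcontr x
          gcongr
      _ = (1 - (1 - r) / h * s) * N x := by ring

/-- Block triangular operators with contracting diagonal blocks are contracting. -/
theorem HasContractingEulerSteps.prod {F : Type*} [NormedAddCommGroup F] [NormedSpace ℝ F]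
    {A₁ : E →L[ℝ] E} {A₂ : F →L[ℝ] F} (h₁ : HasContractingEulerSteps A₁)
    (h₂ : HasContractingEulerSteps A₂) (C : E →L[ℝ] F) (A : E × F →L[ℝ] E × F)
    (hA : ∀ p, A p = (A₁ p.1, C p.1 + A₂ p.2)) :
    HasContractingEulerSteps A := by
  obtain ⟨N₁, hN₁, ⟨M₁, hM₁0, hM₁⟩, c₁, hc₁, t₁, ht₁, hs₁⟩ := h₁
  obtain ⟨N₂, hN₂, ⟨M₂, hM₂0, hM₂⟩, c₂, hc₂, t₂, ht₂, hs₂⟩ := h₂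
  set D := M₂ * ‖C‖ with hD
  have hD0 : 0 ≤ D := by positivity
  have hC : ∀ e, N₂ (C e) ≤ D * N₁ e := fun e =>
    calc N₂ (C e) ≤ M₂ * ‖C e‖ := hM₂ _
      _ ≤ M₂ * (‖C‖ * ‖e‖) := by gcongr; exact C.le_opNorm e
      _ = D * ‖e‖ := by ring
      _ ≤ D * N₁ e := by gcongr; exact hN₁ e
  -- The weight makes half of the decay of the first component absorb the coupling `D`; the `+ 1`
  -- ensures `K ≥ 1`, so `N` dominates the norm.
  let K : NNReal := ⟨2 * D / c₁ + 1, by positivity⟩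
  have hK1 : (1 : ℝ) ≤ K := le_add_of_nonneg_left (by positivity)
  have hKD : D ≤ K * (c₁ / 2) := by
    change D ≤ (2 * D / c₁ + 1) * (c₁ / 2)
    have : (2 * D / c₁ + 1) * (c₁ / 2) = D + c₁ / 2 := by field_simp
    linarith
  let N : Seminorm ℝ (E × F) := K • N₁.comp (LinearMap.fst ℝ E F) + N₂.comp (LinearMap.snd ℝ E F)
  have hN : ∀ p, N p = K * N₁ p.1 + N₂ p.2 := fun p => rfl
  refine ⟨N, fun p => ?_, ⟨K * M₁ + M₂, by positivity, fun p => ?_⟩, min (c₁ / 2) c₂,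
    lt_min (by positivity) hc₂, min t₁ t₂, lt_min ht₁ ht₂, fun s hs hst p => ?_⟩
  · have a1 := apply_nonneg N₁ p.1
    have a2 := apply_nonneg N₂ p.2
    rw [hN, Prod.norm_def]
    exact max_le (by nlinarith [hN₁ p.1]) (by nlinarith [hN₂ p.2])
  · rw [hN]
    have b1 : N₁ p.1 ≤ M₁ * ‖p‖ :=
      (hM₁ _).trans (mul_le_mul_of_nonneg_left (norm_fst_le p) hM₁0.le)
    have b2 : N₂ p.2 ≤ M₂ * ‖p‖ :=
      (hM₂ _).trans (mul_le_mul_of_nonneg_left (norm_snd_le p) hM₂0.le)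
    nlinarith
  · have d1 := hs₁ s hs (hst.trans (min_le_left _ _)) p.1
    have d2 := hs₂ s hs (hst.trans (min_le_right _ _)) p.2
    have d3 : N₂ (p.2 + s • (C p.1 + A₂ p.2)) ≤ N₂ (p.2 + s • A₂ p.2) + s * N₂ (C p.1) := by
      have := map_add_le_add N₂ (p.2 + s • A₂ p.2) (s • C p.1)
      rw [map_smul_eq_mul, Real.norm_of_nonneg hs] at this
      rwa [show p.2 + s • A₂ p.2 + s • C p.1 = p.2 + s • (C p.1 + A₂ p.2) by
        rw [smul_add]; abel] at this
    have a1 := apply_nonneg N₁ p.1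
    have a2 := apply_nonneg N₂ p.2
    have e1 := mul_le_mul_of_nonneg_left (hC p.1) hs
    have e2 := mul_le_mul_of_nonneg_left d1 K.coe_nonneg
    have e3 := mul_le_mul_of_nonneg_right (mul_le_mul_of_nonneg_left hKD hs) a1
    have e4 : min (c₁ / 2) c₂ * (s * (K * N₁ p.1)) ≤ c₁ / 2 * (s * (K * N₁ p.1)) :=
      mul_le_mul_of_nonneg_right (min_le_left _ _) (by positivity)
    have e5 : min (c₁ / 2) c₂ * (s * N₂ p.2) ≤ c₂ * (s * N₂ p.2) :=
      mul_le_mul_of_nonneg_right (min_le_right _ _) (by positivity)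
    rw [hN, hN, hA]
    change K * N₁ (p.1 + s • A₁ p.1) + N₂ (p.2 + s • (C p.1 + A₂ p.2)) ≤ _
    nlinarith

end Decay

/-! ### Hurwitz matrices -/

section Matrix

variable {ι : Type*} [Fintype ι] [DecidableEq ι]

attribute [local instance] Matrix.linftyOpNormedRing Matrix.linftyOpNormedAlgebra in
-- By Gelfand's formula, `‖B ^ k‖ ≤ q ^ k` eventually, for any `q` strictly between the spectral
-- radius and `1`.
theorem Matrix.tendsto_pow_apply_of_spectrum_norm_lt_one {B : Matrix ι ι ℂ}
    (hB : ∀ z ∈ spectrum ℂ B, ‖z‖ < 1) (i j : ι) :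
    Tendsto (fun k : ℕ => (B ^ k) i j) atTop (𝓝 0) := by
  have : Nonempty ι := ⟨i⟩
  have : CompleteSpace (Matrix ι ι ℂ) := FiniteDimensional.complete ℂ _
  have hr : spectralRadius ℂ B < ((1 : NNReal) : ENNReal) :=
    spectrum.spectralRadius_lt_of_forall_lt B fun z hz => by
      rw [← NNReal.coe_lt_coe]
      exact hB z hz
  obtain ⟨q, hq1, hq2⟩ := ENNReal.lt_iff_exists_nnreal_btwn.1 hr
  have hev := (spectrum.pow_nnnorm_pow_one_div_tendsto_nhds_spectralRadius B).eventually
    (gt_mem_nhds hq1)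
  have hnorm : Tendsto (fun k : ℕ => ‖B ^ k‖) atTop (𝓝 0) := by
    refine squeeze_zero' (Eventually.of_forall fun _ => norm_nonneg _) ?_
      (tendsto_pow_atTop_nhds_zero_of_lt_one q.coe_nonneg
        (NNReal.coe_lt_coe.2 (ENNReal.coe_lt_coe.1 hq2)))
    filter_upwards [hev, eventually_gt_atTop 0] with k hk hk0
    have hk0' : (0 : ℝ) < k := Nat.cast_pos.2 hk0
    have h1 := ENNReal.rpow_le_rpow hk.le hk0'.le
    rw [← ENNReal.rpow_mul, one_div_mul_cancel hk0'.ne', ENNReal.rpow_one,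
      ENNReal.rpow_natCast] at h1
    exact_mod_cast h1
  exact ((continuous_apply j).comp (continuous_apply i)).tendsto' _ _ rfl |>.comp
    (tendsto_zero_iff_norm_tendsto_zero.2 hnorm)

/-- `|1 + h s|² = 1 + h (2 Re s + h |s|²)` is below `1` for small `h > 0` when `Re s < 0`. The
spectrum is finite, so one `h` serves all eigenvalues. -/
theorem IsHurwitz.exists_tendsto_pow {M : Matrix ι ι ℝ} (hM : IsHurwitz M) :
    ∃ h : ℝ, 0 < h ∧ Tendsto (fun k : ℕ => (1 + h • M) ^ k) atTop (𝓝 0) := by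
  set Mc : Matrix ι ι ℂ := M.map Complex.ofRealHom with hMc
  have hspec : ∀ s ∈ spectrum ℂ Mc, s.re < 0 := by
    intro s hs
    refine hM s ?_
    rw [spectrum.mem_iff, Matrix.isUnit_iff_isUnit_det, isUnit_iff_ne_zero, not_not,
      Algebra.algebraMap_eq_smul_one] at hs
    exact hs
  have hpt : ∀ s ∈ spectrum ℂ Mc, ∀ᶠ h : ℝ in 𝓝[>] 0, ‖1 + (h : ℂ) * s‖ < 1 := by
    intro s hs
    have hre := hspec s hs
    have hpos : 0 < -s.re / (Complex.normSq s + 1) :=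
      div_pos (by linarith) (by linarith [Complex.normSq_nonneg s])
    filter_upwards [Ioo_mem_nhdsGT hpos] with h hh
    have h1 : h * (Complex.normSq s + 1) < -s.re :=
      (lt_div_iff₀ (by linarith [Complex.normSq_nonneg s])).1 hh.2
    rw [← sq_lt_one_iff₀ (norm_nonneg _), ← Complex.normSq_eq_norm_sq]
    have h2 : Complex.normSq (1 + (h : ℂ) * s) = 1 + h * (2 * s.re + h * Complex.normSq s) := by
      simp only [Complex.normSq_apply, Complex.add_re, Complex.add_im, Complex.mul_re,
        Complex.mul_im, Complex.ofReal_re, Complex.ofReal_im, Complex.one_re, Complex.one_im]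
      ring
    rw [h2]
    nlinarith [hh.1, Complex.normSq_nonneg s]
  have hall : ∀ᶠ h : ℝ in 𝓝[>] 0, ∀ s ∈ spectrum ℂ Mc, ‖1 + (h : ℂ) * s‖ < 1 :=
    (eventually_all_finite (Matrix.finite_spectrum Mc)).2 hpt
  obtain ⟨h, hh, hh0⟩ := (hall.and self_mem_nhdsWithin).exists
  have hh0 : 0 < h := hh0
  have hhC : (h : ℂ) ≠ 0 := Complex.ofReal_ne_zero.2 hh0.ne'
  have hB : ∀ z ∈ spectrum ℂ (1 + (h : ℂ) • Mc), ‖z‖ < 1 := by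
    intro z hz
    -- Spectral mapping for an affine map: `z - (1 + h M) = h ((z - 1)/h - M)`.
    have hs : (z - 1) / h ∈ spectrum ℂ Mc := by
      rw [spectrum.mem_iff] at hz ⊢
      contrapose! hz
      have : algebraMap ℂ (Matrix ι ι ℂ) z - (1 + (h : ℂ) • Mc) =
          Units.mk0 (h : ℂ) hhC • (algebraMap ℂ (Matrix ι ι ℂ) ((z - 1) / h) - Mc) := by
        rw [Units.smul_mk0, smul_sub, Algebra.algebraMap_eq_smul_one,
          Algebra.algebraMap_eq_smul_one, smul_smul, mul_div_cancel₀ _ hhC, sub_smul, one_smul]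
        abel
      rw [this]
      exact hz.smul _
    have := hh _ hs
    rwa [mul_div_cancel₀ _ hhC, add_sub_cancel] at this
  refine ⟨h, hh0, tendsto_pi_nhds.2 fun i => tendsto_pi_nhds.2 fun j => ?_⟩
  have hlim := Matrix.tendsto_pow_apply_of_spectrum_norm_lt_one hB i j
  have hmap : ∀ k : ℕ, ((1 + (h : ℂ) • Mc) ^ k) i j = (((1 + h • M) ^ k) i j : ℝ) := by
    intro k
    have h1 : 1 + (h : ℂ) • Mc = Complex.ofRealHom.mapMatrix (1 + h • M) := by
      rw [map_add, map_one]
      congr 1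
      ext a b
      simp [hMc]
    rw [h1, ← map_pow]
    rfl
  simp only [hmap] at hlim
  exact (Complex.continuous_re.tendsto' 0 0 rfl).comp hlim

theorem IsHurwitz.hasContractingEulerSteps {M : Matrix ι ι ℝ} (hM : IsHurwitz M) :
    HasContractingEulerSteps (LinearMap.toContinuousLinearMap (Matrix.toLin' M)) := by
  obtain ⟨h, hh, hlim⟩ := hM.exists_tendsto_pow
  let Φ : Matrix ι ι ℝ →ₗ[ℝ] ((ι → ℝ) →L[ℝ] (ι → ℝ)) :=
    LinearMap.toContinuousLinearMap.toLinearMap ∘ₗ Matrix.toLin'.toLinearMap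
  have hpow : ∀ k : ℕ, Φ ((1 + h • M) ^ k) = (1 + h • Φ M) ^ k := by
    intro k
    induction k with
    | zero => ext1 x; simp [Φ]
    | succ k ih =>
      rw [pow_succ, pow_succ, ← ih]
      ext1 x
      simp [Φ]
  refine hasContractingEulerSteps_of_tendsto_pow hh ?_
  have := ((LinearMap.continuous_of_finiteDimensional Φ).tendsto' 0 0 (map_zero Φ)).comp hlim
  exact this.congr hpow

/-- If no block of `s - M` were singular, the block diagonal matrix of the inverses would invert the
whole. -/
theorem isHurwitz_blockDiagonal' {o : Type*} [Fintype o] [DecidableEq o] {m : o → Type*}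
    [∀ q, Fintype (m q)] [∀ q, DecidableEq (m q)] {M : ∀ q, Matrix (m q) (m q) ℝ}
    (hM : ∀ q, IsHurwitz (M q)) : IsHurwitz (Matrix.blockDiagonal' M) := by
  intro s hs
  have h1 : s • (1 : Matrix ((q : o) × m q) ((q : o) × m q) ℂ) -
      (Matrix.blockDiagonal' M).map (fun a : ℝ => (a : ℂ)) =
      Matrix.blockDiagonal' fun q => s • (1 : Matrix (m q) (m q) ℂ) -
        (M q).map (fun a : ℝ => (a : ℂ)) := by
    rw [Matrix.blockDiagonal'_map _ _ Complex.ofReal_zero, ← Matrix.blockDiagonal'_one,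
      ← Matrix.blockDiagonal'_smul, ← Matrix.blockDiagonal'_sub]
    rfl
  rw [h1] at hs
  obtain ⟨q, hq⟩ : ∃ q, (s • (1 : Matrix (m q) (m q) ℂ) -
      (M q).map (fun a : ℝ => (a : ℂ))).det = 0 := by
    by_contra! hne
    refine (Matrix.isUnit_det_of_right_inverse (B := Matrix.blockDiagonal' fun q =>
      (s • (1 : Matrix (m q) (m q) ℂ) - (M q).map (fun a : ℝ => (a : ℂ)))⁻¹) ?_).ne_zero hs
    rw [← Matrix.blockDiagonal'_mul, ← Matrix.blockDiagonal'_one]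
    congr 1
    ext1 q
    exact Matrix.mul_nonsing_inv _ (hne q).isUnit
  exact hM q s hq

end Matrix

/-! ### The error and collective zero dynamics -/

theorem contDiffAt_uncurry_FInt {n F m : ℕ} {ρ : Fin 3 → ℕ}
    {fint : Vehicle n F → (Fin m → ℝ) → (((q : Fin 3) × Fin (ρ q)) → ℝ) → (Fin m → ℝ)}
    (hsmooth : ∀ i, ContDiffAt ℝ 1
      (fun p : (Fin m → ℝ) × (((q : Fin 3) × Fin (ρ q)) → ℝ) => fint i p.1 p.2) 0) :
    ContDiffAt ℝ 1 (fun p : (ExtIndex n F ρ → ℝ) × (Vehicle n F × Fin m → ℝ) =>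
      FInt fint p.2 p.1) 0 := by
  refine contDiffAt_pi.2 fun a => ?_
  let π : (ExtIndex n F ρ → ℝ) × (Vehicle n F × Fin m → ℝ) →
      (Fin m → ℝ) × (((q : Fin 3) × Fin (ρ q)) → ℝ) :=
    fun p => (fun b => p.2 (a.1, b), fun c => p.1 ⟨c.1, (c.2, a.1)⟩)
  have hπ : ContDiff ℝ 1 π := by
    refine ContDiff.prodMk (contDiff_pi.2 fun b => ?_) (contDiff_pi.2 fun c => ?_)
    · exact (contDiff_apply ℝ ℝ (a.1, b)).comp contDiff_snd
    · exact (contDiff_apply ℝ ℝ (⟨c.1, (c.2, a.1)⟩ : ExtIndex n F ρ)).comp contDiff_fst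
  have h1 : ContDiffAt ℝ 1
      (fun p : (Fin m → ℝ) × (((q : Fin 3) × Fin (ρ q)) → ℝ) => fint a.1 p.1 p.2 a.2) (π 0) :=
    contDiffAt_pi.1 (hsmooth a.1) a.2
  exact h1.comp 0 hπ.contDiffAt

theorem ReferenceNetwork.isHurwitz_ASys {n F Na : ℕ} (R : ReferenceNetwork n F Na)
    {γ : ℕ → Vehicle n F → ℝ} {Ξ : ℕ} {ρ : Fin 3 → ℕ}
    (hgains : ∀ q, IsHurwitz (R.ASysq γ Ξ (ρ q))) : IsHurwitz (R.ASys γ Ξ ρ) :=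
  isHurwitz_blockDiagonal' hgains

/-- The error field without input as a continuous linear map. -/
noncomputable def ReferenceNetwork.errorCLM {n F Na : ℕ} (R : ReferenceNetwork n F Na)
    (γ : ℕ → Vehicle n F → ℝ) (Ξ : ℕ) (ρ : Fin 3 → ℕ) :
    (ExtIndex n F ρ → ℝ) →L[ℝ] (ExtIndex n F ρ → ℝ) :=
  LinearMap.toContinuousLinearMap (Matrix.toLin' (R.ASys γ Ξ ρ))

theorem ReferenceNetwork.errorField_zero_input {n F Na : ℕ} (R : ReferenceNetwork n F Na)
    (γ : ℕ → Vehicle n F → ℝ) (Ξ : ℕ) (ρ : Fin 3 → ℕ) :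
    R.errorField γ Ξ ρ 0 = R.errorCLM γ Ξ ρ := by
  ext1 E
  simp [errorField, errorCLM, Matrix.toLin'_apply]

theorem theorem2 {n F Na m : ℕ} (R : ReferenceNetwork n F Na)
    (ρ : Fin 3 → ℕ) (Ξ : ℕ) (γ : ℕ → Vehicle n F → ℝ)
    (fint : Vehicle n F → (Fin m → ℝ) → (((q : Fin 3) × Fin (ρ q)) → ℝ) → (Fin m → ℝ))
    -- the internal dynamics are continuously differentiable near the origin
    (hsmooth : ∀ i, ContDiffAt ℝ 1
      (fun p : (Fin m → ℝ) × (((q : Fin 3) × Fin (ρ q)) → ℝ) => fint i p.1 p.2) 0)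
    (hgains : ∀ q, IsHurwitz (R.ASysq γ Ξ (ρ q)))
    (hzero : IsLocallyAsymptoticallyStable (fun ω : Vehicle n F × Fin m → ℝ => FInt fint ω 0))
    (hjac : IsHurwitz (FIntJacobian fint)) :
    -- the error zero dynamics
    IsLocallyAsymptoticallyStable (fun E : ExtIndex n F ρ → ℝ => R.errorField γ Ξ ρ 0 E) ∧
    -- the collective zero dynamics, error coupled with internal state
    IsLocallyAsymptoticallyStable
      (fun p : (ExtIndex n F ρ → ℝ) × (Vehicle n F × Fin m → ℝ) =>
        (R.errorField γ Ξ ρ 0 p.1, FInt fint p.2 p.1)) := by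
  have hA : HasContractingEulerSteps (R.errorCLM γ Ξ ρ) :=
    (R.isHurwitz_ASys hgains).hasContractingEulerSteps
  simp only [R.errorField_zero_input]
  constructor
  · refine HasContractingEulerSteps.isLocallyAsymptoticallyStable
      (R.errorCLM γ Ξ ρ).contDiff.contDiffAt (map_zero _) ?_
    rwa [(R.errorCLM γ Ξ ρ).hasFDerivAt.fderiv]
  · set G := fun p : (ExtIndex n F ρ → ℝ) × (Vehicle n F × Fin m → ℝ) => FInt fint p.2 p.1
    have hG : ContDiffAt ℝ 1 G 0 := contDiffAt_uncurry_FInt hsmooth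
    have hG' : HasFDerivAt G (fderiv ℝ G 0) 0 := (hG.differentiableAt (by simp)).hasFDerivAt
    -- By the chain rule along `ω ↦ (0, ω)`, the Jacobian `∂F_INT/∂ω` is the restriction of the full
    -- derivative of `G` to the second factor.
    have hJ : HasFDerivAt (fun ω => FInt fint ω (0 : ExtIndex n F ρ → ℝ))
        ((fderiv ℝ G 0).comp (ContinuousLinearMap.inr ℝ _ _)) 0 := by
      have h1 : HasFDerivAt G (fderiv ℝ G 0) (ContinuousLinearMap.inr ℝ
          (ExtIndex n F ρ → ℝ) (Vehicle n F × Fin m → ℝ) 0) := by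
        rwa [map_zero]
      exact h1.comp 0 (ContinuousLinearMap.inr ℝ
        (ExtIndex n F ρ → ℝ) (Vehicle n F × Fin m → ℝ)).hasFDerivAt
    have hJstep : HasContractingEulerSteps
        ((fderiv ℝ G 0).comp (ContinuousLinearMap.inr ℝ _ _)) := by
      have h1 := hjac.hasContractingEulerSteps
      rw [FIntJacobian, Matrix.toLin'_toMatrix', hJ.fderiv] at h1
      exact h1
    refine HasContractingEulerSteps.isLocallyAsymptoticallyStable
      (((R.errorCLM γ Ξ ρ).contDiff.comp contDiff_fst).contDiffAt.prodMk hG)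
      (Prod.ext (map_zero _) hzero.equilibrium) ?_
    have hd := ((R.errorCLM γ Ξ ρ).hasFDerivAt.comp
      (0 : (ExtIndex n F ρ → ℝ) × (Vehicle n F × Fin m → ℝ)) hasFDerivAt_fst).prodMk hG'
    -- The coupling block is the derivative of `G` in the error directions. It needs no sign or size
    -- condition, only boundedness.
    refine hA.prod hJstep ((fderiv ℝ G 0).comp (ContinuousLinearMap.inl ℝ _ _)) _ fun p => ?_
    have hd' : fderiv ℝ (fun p : (ExtIndex n F ρ → ℝ) × (Vehicle n F × Fin m → ℝ) =>
        (R.errorCLM γ Ξ ρ p.1, G p)) 0 = _ := hd.fderiv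
    rw [hd']
    refine Prod.ext rfl ?_
    change fderiv ℝ G 0 p = fderiv ℝ G 0 (p.1, 0) + fderiv ℝ G 0 (0, p.2)
    rw [← map_add]
    simp
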